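/- Let $\lambda\in(-\tfrac32,-\tfrac12)$, $\lambda\neq-1$, and let $C_m=C_m^\lambda$ ($m\ge 0$) be the monic ultraspherical polynomials, defined by $C_0(x)=1$, $C_1(x)=x$ and $$C_m(x)=xC_{m-1}(x)-b_mC_{m-2}(x),\qquad b_m=\frac{(m-1)(m-2+2\lambda)}{4(m-2+\lambda)(m-1+\lambda)}\qquad(m\ge2).$$ Fix $n\ge5$ and $\varepsilon>0$. Then $C_{n-2}$ has a largest real zero $x_{n-2,n-2}$, and $x_{n-2,n-2}>1$. Put $a_n=x_{n-2,n-2}+\varepsilon$. Define monic polynomials $D_m$ $(m\ge 0)$ as follows: $$D_n(x)=(x^2-1)C_{n-2}(x),\qquad D_{n-1}(x)=C_{n-1}(x),$$ $$D_{n-j}(x)=-\frac1{\ell_{n-j+2}}\bigl[D_{n-j+2}(x)-xD_{n-j+1}(x)\bigr]\quad(j=2,\dots,n),$$ $$D_{n+j}(x)=xD_{n+j-1}(x)-\ell_{n+j}D_{n+j-2}(x)\quad(j=1,2,\dots),$$ where $\ell_m=\beta_{2,m-1}-\beta_{2,m}$ for $2\le m\le n$, $\beta_{2,m}$ being the coefficient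 of $x^{m-2}$ in $D_m$ (and $\beta_{2,1}=0$), and where the $\ell_{n+j}$, $j\ge1$, are chosen one after the other, arbitrarily subject to $$\ell_{n+j}\in\Bigl(0,\ \frac{a_nD_{n+j-1}(a_n)}{D_{n+j-2}(a_n)}\Bigr).$$ Then: 1. At every step the upper bound $a_nD_{n+j-1}(a_n)/D_{n+j-2}(a_n)$ is positive, so such choices are possible; and $\ell_m>0$ for $2\le m\le n$. 2. For every such choice, each $D_m$ is monic of degree $m$ and $D_m(-x)=(-1)^mD_m(x)$ (the sequence is symmetric). 3. For every such choice, $\{D_m\}_{m=0}^\infty$ is orthogonal with respect to a positive measure supported on the closed interval $[-a_n,a_n]$: there is a positive measure $\mu$ on $\mathbb R$ with all moments finite and $\mu(\mathbb R\setminus[-a_n,a_n])=0$ such that $\int D_iD_j\,d\mu=0$ for $i\ne j$ and $\int D_i^2\,d\mu>0$ for all $i$. 4. For every such choice, all the (complex) zeros of every $D_m$, $m\ge 0$, are real and lie in the open interval $(-a_n,a_n)$. -/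

import Mathlib

open Polynomial MeasureTheory

noncomputable section

/-- The recurrence coefficient `b_m = (m-1)(m-2+2λ) / (4(m-2+λ)(m-1+λ))` of the monic
ultraspherical polynomials. -/
def ultrasphericalCoeff (lam : ℝ) (m : ℕ) : ℝ :=
  (((m : ℝ) - 1) * ((m : ℝ) - 2 + 2 * lam)) /
    (4 * ((m : ℝ) - 2 + lam) * ((m : ℝ) - 1 + lam))

/-- The monic ultraspherical polynomial `C_m^λ`: `C_0 = 1` and `C_m = x C_{m-1} - b_m C_{m-2}`
for `m ≥ 1`, where `C_{-1} = 0` (so that `C_1 = x`). -/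
def ultraspherical (lam : ℝ) : ℕ → ℝ[X]
  | 0 => 1
  | 1 => X
  | m + 2 => X * ultraspherical lam (m + 1)
      - C (ultrasphericalCoeff lam (m + 2)) * ultraspherical lam m

/-- The largest real zero of a polynomial (meaningful when there is one: the set of real zeros
of a nonzero polynomial is finite, so that its supremum is then a maximum). -/
def largestZero (P : ℝ[X]) : ℝ := sSup {x : ℝ | P.IsRoot x}

/-- The coefficient of `x^(m-2)` in `P` (intended for `P` of degree `m`); it is `0` if `m < 2`,
there being no negative powers. -/
def subsubleadingCoeff (m : ℕ) (P : ℝ[X]) : ℝ := if 2 ≤ m then P.coeff (m - 2) else 0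

/-- The backward recurrence; `wendroffBackward n lam k` is `D_{n-k}` for `k ≤ n`:
`D_n = (x² - 1) C_{n-2}`, `D_{n-1} = C_{n-1}` and
`D_{n-k-2} = -(1/ℓ_{n-k}) (D_{n-k} - x D_{n-k-1})`, where `ℓ_{n-k}` is the coefficient of
`x^(n-k-3)` in `D_{n-k-1}` minus the coefficient of `x^(n-k-2)` in `D_{n-k}`. -/
def wendroffBackward (n : ℕ) (lam : ℝ) : ℕ → ℝ[X]
  | 0 => (X ^ 2 - 1) * ultraspherical lam (n - 2)
  | 1 => ultraspherical lam (n - 1)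
  | k + 2 =>
      -C (1 / (subsubleadingCoeff (n - k - 1) (wendroffBackward n lam (k + 1))
          - subsubleadingCoeff (n - k) (wendroffBackward n lam k)))
        * (wendroffBackward n lam k - X * wendroffBackward n lam (k + 1))

/-- The forward recurrence; `wendroffForward n lam ℓ k` is `D_{n+k}`:
`D_{n+k} = x D_{n+k-1} - ℓ_{n+k} D_{n+k-2}` for `k ≥ 1`, starting from
`D_n = (x² - 1) C_{n-2}` and `D_{n-1} = C_{n-1}`. -/
def wendroffForward (n : ℕ) (lam : ℝ) (ℓ : ℕ → ℝ) : ℕ → ℝ[X]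
  | 0 => (X ^ 2 - 1) * ultraspherical lam (n - 2)
  | 1 => X * ((X ^ 2 - 1) * ultraspherical lam (n - 2))
      - C (ℓ (n + 1)) * ultraspherical lam (n - 1)
  | k + 2 => X * wendroffForward n lam ℓ (k + 1)
      - C (ℓ (n + k + 2)) * wendroffForward n lam ℓ k

/-- The sequence `D_0, D_1, D_2, …` generated by `D_n = (x² - 1) C_{n-2}^λ` and
`D_{n-1} = C_{n-1}^λ`. Only the values `ℓ m` with `m > n`, the freely chosen forward
coefficients, are used. -/
def wendroffSeq (n : ℕ) (lam : ℝ) (ℓ : ℕ → ℝ) (m : ℕ) : ℝ[X] :=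
  if m < n then wendroffBackward n lam (n - m) else wendroffForward n lam ℓ (m - n)

/-- `ℓ_{n+j}` lies in the open interval `(0, a D_{n+j-1}(a) / D_{n+j-2}(a))`. -/
def AdmissibleAt (n : ℕ) (lam a : ℝ) (ℓ : ℕ → ℝ) (j : ℕ) : Prop :=
  ℓ (n + j) ∈ Set.Ioo (0 : ℝ)
    (a * (wendroffSeq n lam ℓ (n + j - 1)).eval a / (wendroffSeq n lam ℓ (n + j - 2)).eval a)

/-- `P_0, P_1, …` is a sequence of monic polynomials, `P_m` of degree `m`, that is orthogonal
with respect to the (positive) measure `μ`. Integrability of the products `P_i P_j` amounts to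
finiteness of all moments of `μ`. -/
structure IsMonicOrthogonal (P : ℕ → ℝ[X]) (μ : Measure ℝ) : Prop where
  monic : ∀ m, (P m).Monic
  natDegree_eq : ∀ m, (P m).natDegree = m
  integrable_mul : ∀ i j, Integrable (fun x => (P i).eval x * (P j).eval x) μ
  orthogonal : ∀ i j, i ≠ j → ∫ x, (P i).eval x * (P j).eval x ∂μ = 0
  norm_pos : ∀ i, 0 < ∫ x, (P i).eval x * (P i).eval x ∂μ

end

/-! The proof is Wendroff's construction followed by a Favard argument. At each zero x of A = (X² -
1) C_{n-2}, the structure relation for the derivative gives A'(x) C_{n-1}(x) > 0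
(`wendroff_interlacing`). The zeros of A are real because C_{n-2}^λ is a quasi-orthogonal
combination of polynomials with the classical parameter λ + 1 (`ultraspherical_im_eq_zero`). So 1 /
(A' C_{n-1}) is a positive weight on the zeros of A, and it makes D_n and D_{n-1} discretely
orthogonal.

Orthogonality descends through the backward recurrence, and each ℓ_m is a ratio of squared norms,
hence positive (`IsSymmMonicOrthogonal.backward`). As `a` lies to the right of all nodes, D_m(a) > 0
for m ≤ n. For m > n the upper bound imposed on ℓ_m says exactly that D_m(a) > 0.

Positive coefficients together with D_m(a) > 0 for all m confine every zero to (-a, a). The Gauss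
quadrature measures therefore live on the compact interval [-a, a], and a weak limit of them is the
orthogonality measure (`IsThreeTerm.exists_measure`). -/

/-! ### Symmetric three-term recurrences and the location of zeros. -/

/-- `D` satisfies the symmetric three-term recurrence with coefficients `c`. -/
structure IsThreeTerm (c : ℕ → ℝ) (D : ℕ → ℝ[X]) : Prop where
  zero : D 0 = 1
  one : D 1 = X
  add_two : ∀ k, D (k + 2) = X * D (k + 1) - C (c k) * D k

/-- The map r ↦ -1/r preserves the upper half-plane. With r = D_{k+1}(z) / D_k(z) this is one step
of the recurrence. -/
lemma Complex.im_sub_ofReal_div_pos {z r : ℂ} {e : ℝ} (hz : 0 < z.im) (hr : 0 < r.im)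
    (he : 0 ≤ e) : 0 < (z - e / r).im := by
  have h : (z - e / r).im = z.im + e * (r.im / Complex.normSq r) := by
    simp [div_eq_mul_inv, Complex.inv_im]
  rw [h]
  have := Complex.normSq_nonneg r
  positivity

/-- A polynomial with definite parity and no zeros in the upper half-plane has only real zeros. -/
lemma im_eq_zero_of_aeval_eq_zero {P : ℝ[X]} {k : ℕ} (hpar : P.comp (-X) = (-1) ^ k * P)
    (hP : ∀ z : ℂ, 0 < z.im → aeval z P ≠ 0) {z : ℂ} (hz : aeval z P = 0) : z.im = 0 := by
  rcases lt_trichotomy z.im 0 with h | h | h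
  · refine absurd ?_ (hP (-z) (by simpa using h))
    have := congrArg (aeval z) hpar
    rw [aeval_comp] at this
    simpa [hz] using this
  · exact h
  · exact absurd hz (hP z h)

namespace IsThreeTerm

variable {c : ℕ → ℝ} {D : ℕ → ℝ[X]}

lemma monic_natDegree (h : IsThreeTerm c D) (k : ℕ) :
    (D k).Monic ∧ (D k).natDegree = k ∧ (D (k + 1)).Monic ∧ (D (k + 1)).natDegree = k + 1 := by
  induction k with
  | zero => simp [h.zero, h.one, monic_X]
  | succ k ih =>
    obtain ⟨h1, h2, h3, h4⟩ := ih
    have hX : (X * D (k + 1)).Monic := monic_X.mul h3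
    have hXd : (X * D (k + 1)).natDegree = k + 2 := by
      rw [natDegree_X_mul h3.ne_zero, h4]
    have hlt : (C (c k) * D k).natDegree < (X * D (k + 1)).natDegree := by
      have := natDegree_C_mul_le (c k) (D k)
      lia
    refine ⟨h3, h4, ?_, ?_⟩
    · rw [h.add_two]
      exact hX.sub_of_left (degree_lt_degree hlt)
    · rw [h.add_two, natDegree_sub_eq_left_of_natDegree_lt hlt, hXd]

lemma monic (h : IsThreeTerm c D) (k : ℕ) : (D k).Monic := (h.monic_natDegree k).1

lemma natDegree_eq (h : IsThreeTerm c D) (k : ℕ) : (D k).natDegree = k :=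
  (h.monic_natDegree k).2.1

lemma comp_neg_X (h : IsThreeTerm c D) (k : ℕ) : (D k).comp (-X) = (-1) ^ k * D k := by
  induction k using Nat.twoStepInduction with
  | zero => simp [h.zero]
  | one => simp [h.one]
  | more k h1 h2 =>
    rw [h.add_two, sub_comp, mul_comp, mul_comp, h1, h2, X_comp, C_comp]
    ring

lemma eval_add_two (h : IsThreeTerm c D) (k : ℕ) (x : ℝ) :
    (D (k + 2)).eval x = x * (D (k + 1)).eval x - c k * (D k).eval x := by
  simp [h.add_two]

lemma eval_neg (h : IsThreeTerm c D) (k : ℕ) (x : ℝ) :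
    (D k).eval (-x) = (-1) ^ k * (D k).eval x := by
  have := congrArg (eval x) (h.comp_neg_X k)
  simpa [eval_comp] using this

/-- Consecutive terms have no common zero. -/
lemma eval_ne_zero_of_eval_succ_eq_zero (h : IsThreeTerm c D) (hc : ∀ k, c k ≠ 0) {x : ℝ} (k : ℕ)
    (h1 : (D (k + 1)).eval x = 0) : (D k).eval x ≠ 0 := by
  induction k with
  | zero => simp [h.zero]
  | succ k ih =>
    intro h2
    refine ih h2 ?_
    have := h.eval_add_two k x
    rw [h1, h2] at this
    simpa [hc k] using this

lemma upper_half_plane (h : IsThreeTerm c D) (hc : ∀ k, 0 < c k) {z : ℂ} (hz : 0 < z.im) (k : ℕ) :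
    aeval z (D k) ≠ 0 ∧ 0 < (aeval z (D (k + 1)) / aeval z (D k)).im := by
  induction k with
  | zero => simpa [h.zero, h.one] using hz
  | succ k ih =>
    obtain ⟨h1, h2⟩ := ih
    have h3 : aeval z (D (k + 1)) ≠ 0 := by
      intro h0
      simp [h0] at h2
    refine ⟨h3, ?_⟩
    have key : aeval z (D (k + 2)) / aeval z (D (k + 1))
        = z - (c k : ℂ) / (aeval z (D (k + 1)) / aeval z (D k)) := by
      rw [h.add_two]
      simp only [map_sub, map_mul, aeval_X, aeval_C, Complex.coe_algebraMap]
      field_simp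
    rw [key]
    exact Complex.im_sub_ofReal_div_pos hz h2 (hc k).le

/-- The last coefficient `e` need not be `c k`. This freedom is what the connection formula between
λ and λ + 1 requires. -/
lemma aeval_X_mul_sub_ne_zero (h : IsThreeTerm c D) (hc : ∀ k, 0 < c k) {z : ℂ} (hz : 0 < z.im)
    (k : ℕ) {e : ℝ} (he : 0 ≤ e) : aeval z (X * D (k + 1) - C e * D k) ≠ 0 := by
  obtain ⟨h1, h2⟩ := h.upper_half_plane hc hz k
  have h3 := (h.upper_half_plane hc hz (k + 1)).1
  have h4 := Complex.im_sub_ofReal_div_pos hz h2 he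
  intro h0
  have key : z - (e : ℂ) / (aeval z (D (k + 1)) / aeval z (D k))
      = aeval z (X * D (k + 1) - C e * D k) / aeval z (D (k + 1)) := by
    simp only [map_sub, map_mul, aeval_X, aeval_C, Complex.coe_algebraMap]
    field_simp
  rw [key, h0] at h4
  simp at h4

lemma im_eq_zero (h : IsThreeTerm c D) (hc : ∀ k, 0 < c k) {z : ℂ} {k : ℕ}
    (hz : aeval z (D k) = 0) : z.im = 0 :=
  im_eq_zero_of_aeval_eq_zero (h.comp_neg_X k) (fun _ hw => (h.upper_half_plane hc hw k).1) hz

/-- The Wronskians satisfy W_{k+1} = D_{k+1}² + c_k W_k. At a zero of D_{k+1} this yields D_{k+1}'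
D_k > 0, the interlacing condition of `exists_weights`. -/
lemma wronskian_pos (h : IsThreeTerm c D) (hc : ∀ k, 0 < c k) (x : ℝ) (k : ℕ) :
    0 < (D (k + 1)).derivative.eval x * (D k).eval x
      - (D (k + 1)).eval x * (D k).derivative.eval x := by
  induction k with
  | zero => simp [h.zero, h.one]
  | succ k ih =>
    have h1 : (D (k + 2)).derivative.eval x = (D (k + 1)).eval x
        + x * (D (k + 1)).derivative.eval x - c k * (D k).derivative.eval x := by
      simp [h.add_two]
    rw [h1, h.eval_add_two]
    nlinarith [mul_pos (hc k) ih, sq_nonneg ((D (k + 1)).eval x)]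

/-- The ratios r_k = D_{k+1} / D_k obey r_{k+1} = x - c_k / r_k, which increases with x and with
r_k. Positivity alone would not be inductive, so the comparison with `a` is carried along. -/
lemma eval_pos_of_le (h : IsThreeTerm c D) (hc : ∀ k, 0 < c k) {a x : ℝ}
    (ha : ∀ k, 0 < (D k).eval a) (hx : a ≤ x) (k : ℕ) : 0 < (D k).eval x ∧
      (D (k + 1)).eval a / (D k).eval a ≤ (D (k + 1)).eval x / (D k).eval x := by
  induction k with
  | zero => simpa [h.zero, h.one] using hx
  | succ k ih =>
    obtain ⟨h1, h2⟩ := ih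
    have ha' : 0 < (D (k + 1)).eval a / (D k).eval a := div_pos (ha _) (ha _)
    have h3 : 0 < (D (k + 1)).eval x := by
      have := ha'.trans_le h2
      exact (div_pos_iff_of_pos_right h1).1 this
    refine ⟨h3, ?_⟩
    have key (y : ℝ) (hy : 0 < (D k).eval y) (hy' : 0 < (D (k + 1)).eval y) :
        (D (k + 2)).eval y / (D (k + 1)).eval y
          = y - c k / ((D (k + 1)).eval y / (D k).eval y) := by
      rw [h.eval_add_two]
      field_simp
    rw [key a (ha _) (ha _), key x h1 h3]
    have := div_le_div_of_nonneg_left (hc k).le ha' h2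
    linarith

/-- If every term is positive at `a`, all complex zeros lie in the real interval `(-a, a)`. -/
lemma zeros_mem_Ioo (h : IsThreeTerm c D) (hc : ∀ k, 0 < c k) {a : ℝ}
    (ha : ∀ k, 0 < (D k).eval a) {k : ℕ} {z : ℂ} (hz : aeval z (D k) = 0) :
    ∃ x : ℝ, x ∈ Set.Ioo (-a) a ∧ z = (x : ℂ) := by
  have him := h.im_eq_zero hc hz
  have hzx : z = (z.re : ℂ) := Complex.ext (by simp) (by simp [him])
  refine ⟨z.re, ?_, hzx⟩
  have h0 : (D k).eval z.re = 0 := by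
    rw [hzx] at hz
    have : ((aeval z.re (D k) : ℝ) : ℂ) = 0 := by
      rw [← hz]
      exact (aeval_algebraMap_apply ℂ z.re (D k)).symm
    simpa [coe_aeval_eq_eval] using this
  constructor
  · by_contra! hlt
    have := (h.eval_pos_of_le hc ha (x := -z.re) (by linarith) k).1
    rw [h.eval_neg, h0] at this
    simp at this
  · by_contra! hlt
    exact (h.eval_pos_of_le hc ha hlt k).1.ne' h0

end IsThreeTerm

/-! ### Discrete orthogonality on a finite set of nodes. -/

lemma Polynomial.Monic.exists_root_gt {P : ℝ[X]} (hP : P.Monic) {b : ℝ} (hb : P.eval b < 0) :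
    ∃ x, b < x ∧ P.IsRoot x := by
  have hdeg : 0 < P.degree := by
    rw [← natDegree_pos_iff_degree_pos, Nat.pos_iff_ne_zero]
    intro h0
    rw [hP.natDegree_eq_zero.1 h0] at hb
    norm_num at hb
  have htend := P.tendsto_atTop_of_leadingCoeff_nonneg hdeg (by simp [hP.leadingCoeff])
  obtain ⟨c, hc, hbc⟩ := ((htend.eventually_ge_atTop 0).and (Filter.eventually_ge_atTop b)).exists
  obtain ⟨x, hx, hx0⟩ := intermediate_value_Icc hbc P.continuous.continuousOn ⟨hb.le, hc⟩
  refine ⟨x, lt_of_le_of_ne hx.1 ?_, hx0⟩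
  rintro rfl
  exact hb.ne hx0

/-- A monic real polynomial whose complex zeros are real and simple has as many real roots as
its degree, and is the product of the corresponding linear factors. -/
lemma roots_toFinset_of_real_simple {P : ℝ[X]} (hP : P.Monic)
    (hreal : ∀ z : ℂ, aeval z P = 0 → z.im = 0)
    (hsimple : ∀ x : ℝ, P.eval x = 0 → P.derivative.eval x ≠ 0) :
    P.roots.toFinset.card = P.natDegree ∧ P = Lagrange.nodal P.roots.toFinset id := by
  have hsplit : P.Splits := by
    refine Splits.of_splits_map (algebraMap ℝ ℂ) (IsAlgClosed.splits _) fun z hz => ?_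
    have h0 : aeval z P = 0 := by
      have := isRoot_of_mem_roots hz
      rwa [IsRoot, eval_map_algebraMap] at this
    exact ⟨z.re, Complex.ext (by simp) (by simp [hreal z h0])⟩
  have hnodup : P.roots.Nodup := by
    rw [Multiset.nodup_iff_count_le_one]
    intro x
    rw [count_roots]
    by_contra! h
    have := (one_lt_rootMultiplicity_iff_isRoot hP.ne_zero).1 h
    exact hsimple x this.1 this.2
  constructor
  · rw [Multiset.toFinset_card_of_nodup hnodup, hsplit.natDegree_eq_card_roots]
  · conv_lhs => rw [hsplit.eq_prod_roots_of_monic hP]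
    rw [Lagrange.nodal_eq, Finset.prod, Multiset.toFinset_val, hnodup.dedup]
    rfl

/-- The sum is the top coefficient of the Lagrange interpolant of `q`. It vanishes when `q` has
degree below `s.card - 1`, which is the source of orthogonality in `OrthogonalBelow.of_weights`. -/
lemma sum_eval_div_eval_derivative_nodal {s : Finset ℝ} {q : ℝ[X]} (hq : q.degree < s.card) :
    ∑ x ∈ s, q.eval x / (Lagrange.nodal s id).derivative.eval x = q.coeff (s.card - 1) := by
  rw [Lagrange.coeff_eq_sum (v := id) (Set.injOn_id _) hq]
  refine Finset.sum_congr rfl fun x hx => ?_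
  have h := Lagrange.eval_nodal_derivative_eval_node_eq (v := (id : ℝ → ℝ)) hx
  rw [Lagrange.eval_nodal] at h
  simp only [id] at h ⊢
  rw [h]

/-- `p` is orthogonal to all polynomials of degree less than `k` with respect to the discrete
measure with weights `w` on `s`. -/
def OrthogonalBelow (s : Finset ℝ) (w : ℝ → ℝ) (k : ℕ) (p : ℝ[X]) : Prop :=
  ∀ q : ℝ[X], q.degree < k → ∑ x ∈ s, w x * (p.eval x * q.eval x) = 0

lemma sum_mul_sq_pos {s : Finset ℝ} {w : ℝ → ℝ} (hw : ∀ x ∈ s, 0 < w x) {q : ℝ[X]} (hq : q ≠ 0)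
    (hdeg : q.degree < s.card) : 0 < ∑ x ∈ s, w x * (q.eval x * q.eval x) := by
  obtain ⟨x, hx, hqx⟩ : ∃ x ∈ s, q.eval x ≠ 0 := by
    by_contra! h
    exact hq (eq_zero_of_degree_lt_of_eval_finset_eq_zero s hdeg h)
  refine Finset.sum_pos' (fun y hy => mul_nonneg (hw y hy).le (mul_self_nonneg _)) ⟨x, hx, ?_⟩
  exact mul_pos (hw x hx) (mul_self_pos.2 hqx)

namespace OrthogonalBelow

variable {s : Finset ℝ} {w : ℝ → ℝ} {k : ℕ} {p A B : ℝ[X]}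

lemma mono (h : OrthogonalBelow s w k p) {j : ℕ} (hj : j ≤ k) : OrthogonalBelow s w j p :=
  fun q hq => h q (hq.trans_le (by exact_mod_cast hj))

lemma of_vanishing (h : ∀ x ∈ s, p.eval x = 0) : OrthogonalBelow s w k p :=
  fun _ _ => Finset.sum_eq_zero fun x hx => by simp [h x hx]

lemma C_mul (h : OrthogonalBelow s w k p) (c : ℝ) : OrthogonalBelow s w k (C c * p) := by
  intro q hq
  have := h q hq
  calc _ = c * ∑ x ∈ s, w x * (p.eval x * q.eval x) := by
        rw [Finset.mul_sum]
        refine Finset.sum_congr rfl fun x _ => ?_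
        simp only [eval_mul, eval_C]
        ring
    _ = 0 := by rw [this, mul_zero]

/-- For the weights `1 / (A' B)` at the zeros of `A`, the polynomial `B` is orthogonal to all
polynomials of smaller degree. -/
lemma of_weights (hs : s.card = k + 1) (hA : A = Lagrange.nodal s id)
    (hB : ∀ x ∈ s, B.eval x ≠ 0) :
    OrthogonalBelow s (fun x => 1 / (A.derivative.eval x * B.eval x)) k B := by
  intro q hq
  have h0 : q.coeff (s.card - 1) = 0 := coeff_eq_zero_of_degree_lt (by simpa [hs] using hq)
  rw [← sum_eval_div_eval_derivative_nodal (s := s), ← hA] at h0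
  · rw [← h0]
    refine Finset.sum_congr rfl fun x hx => ?_
    have := hB x hx
    field_simp
  · exact hq.trans (by rw [hs]; exact_mod_cast Nat.lt_succ_self k)

/-- One backward step of a three-term recurrence preserves orthogonality. -/
lemma X_mul_sub (hA : OrthogonalBelow s w (k + 1) A) (hB : OrthogonalBelow s w (k + 1) B) :
    OrthogonalBelow s w k (X * B - A) := by
  intro q hq
  have hXq : (X * q).degree < ((k + 1 : ℕ) : WithBot ℕ) := by
    rw [mul_comm, degree_mul_X]
    push_cast
    exact WithBot.add_lt_add_right (by simp) hq
  have h1 := hB _ hXq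
  have h2 := hA q (hq.trans (by exact_mod_cast Nat.lt_succ_self k))
  calc _ = ∑ x ∈ s, w x * (B.eval x * (X * q).eval x) - ∑ x ∈ s, w x * (A.eval x * q.eval x) := by
        rw [← Finset.sum_sub_distrib]
        refine Finset.sum_congr rfl fun x _ => ?_
        simp only [eval_sub, eval_mul, eval_X]
        ring
    _ = 0 := by rw [h1, h2, sub_zero]

/-- An orthogonal monic polynomial is positive to the right of the support. -/
lemma eval_pos (h : OrthogonalBelow s w k p) (hw : ∀ x ∈ s, 0 < w x) (hp : p.Monic)
    (hk : p.natDegree = k) (hks : k ≤ s.card) {a : ℝ} (ha : ∀ x ∈ s, x < a) : 0 < p.eval a := by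
  have hne (y : ℝ) (hy : a ≤ y) : p.eval y ≠ 0 := by
    intro h0
    obtain ⟨q, hq⟩ := dvd_iff_isRoot.2 h0
    have hq0 : q ≠ 0 := by
      rintro rfl
      exact hp.ne_zero (by simpa using hq)
    have hdeg : q.natDegree + 1 = k := by
      rw [← hk, hq, natDegree_mul (X_sub_C_ne_zero y) hq0, natDegree_X_sub_C, add_comm]
    have hdlt : q.degree < k := by
      rw [degree_eq_natDegree hq0]
      exact_mod_cast (by lia : q.natDegree < k)
    -- If p = (X - y) q with y to the right of the nodes, pairing p with q gives -∑ w (y - x) q² <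
    -- 0, against orthogonality.
    have hpos := sum_mul_sq_pos (w := fun x => w x * (y - x))
      (fun x hx => mul_pos (hw x hx) (by linarith [ha x hx])) hq0
      (hdlt.trans_le (by exact_mod_cast hks))
    have hz := h q hdlt
    have : ∑ x ∈ s, w x * (y - x) * (q.eval x * q.eval x)
        = -∑ x ∈ s, w x * (p.eval x * q.eval x) := by
      rw [← Finset.sum_neg_distrib]
      refine Finset.sum_congr rfl fun x _ => ?_
      rw [hq]
      simp only [eval_mul, eval_sub, eval_X, eval_C]
      ring
    rw [this, hz] at hpos
    simp at hpos
  by_contra! hle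
  obtain ⟨y, hy, hy0⟩ := hp.exists_root_gt (hle.lt_of_ne (hne a le_rfl))
  exact hne y hy.le hy0

end OrthogonalBelow

/-- `p` is monic of degree `k`, has the parity of `k`, and is orthogonal to all polynomials of
smaller degree with respect to the weights `w` on `s`. -/
structure IsSymmMonicOrthogonal (s : Finset ℝ) (w : ℝ → ℝ) (k : ℕ) (p : ℝ[X]) : Prop where
  monic : p.Monic
  natDegree_eq : p.natDegree = k
  comp_neg_X : p.comp (-X) = (-1) ^ k * p
  orthogonal : OrthogonalBelow s w k p

lemma coeff_eq_zero_of_comp_neg_X {p : ℝ[X]} {k j : ℕ} (hp : p.comp (-X) = (-1) ^ k * p)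
    (hj : Odd (k + j)) : p.coeff j = 0 := by
  have h := congrArg (fun q => coeff q j) hp
  have hC : ((-1 : ℝ[X]) ^ k) = C ((-1) ^ k) := by simp
  have hX : (-X : ℝ[X]) = C (-1) * X := by simp
  simp only [hC, coeff_C_mul] at h
  rw [hX, comp_C_mul_X_coeff] at h
  have h2 : (-1 : ℝ) ^ k * (-1) ^ j = -1 := by rw [← pow_add]; exact hj.neg_one_pow
  have h3 : (-1 : ℝ) ^ k * (-1) ^ k = 1 := by rw [← pow_add]; exact (Even.add_self k).neg_one_pow
  have : -p.coeff j = p.coeff j := by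
    calc -p.coeff j = (-1) ^ k * (p.coeff j * (-1) ^ j) := by linear_combination (-p.coeff j) * h2
      _ = p.coeff j := by rw [h]; linear_combination p.coeff j * h3
  linarith

/-- In q = X B - A the leading terms cancel and parity kills the next coefficient, so q has degree
at most k, with coefficient l at X^k. Pairing q with itself gives ‖q‖² = l ‖B‖², hence l > 0, and q
/ l is the next polynomial. -/
lemma IsSymmMonicOrthogonal.backward {s : Finset ℝ} {w : ℝ → ℝ} {k : ℕ} {A B : ℝ[X]}
    (hw : ∀ x ∈ s, 0 < w x) (hk : k + 2 ≤ s.card) (hA : IsSymmMonicOrthogonal s w (k + 2) A)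
    (hB : IsSymmMonicOrthogonal s w (k + 1) B) :
    0 < subsubleadingCoeff (k + 1) B - subsubleadingCoeff (k + 2) A ∧
    IsSymmMonicOrthogonal s w k
      (-C (1 / (subsubleadingCoeff (k + 1) B - subsubleadingCoeff (k + 2) A)) * (A - X * B)) := by
  set l := subsubleadingCoeff (k + 1) B - subsubleadingCoeff (k + 2) A with hl
  set q := X * B - A with hq
  have horth : OrthogonalBelow s w k q := (hA.orthogonal.mono (by lia)).X_mul_sub hB.orthogonal
  have hpar : q.comp (-X) = (-1) ^ k * q := by
    rw [hq, sub_comp, mul_comp, X_comp, hA.comp_neg_X, hB.comp_neg_X]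
    ring
  have hcoeff : q.coeff k = l := by
    rw [hq, hl, coeff_sub]
    -- For k = 0 the default value 0 of `subsubleadingCoeff 1` agrees with the zero constant term of
    -- X B.
    cases k with
    | zero => simp [subsubleadingCoeff]
    | succ j => simp [subsubleadingCoeff, coeff_X_mul]
  have hdeg : q.natDegree ≤ k := by
    rw [natDegree_le_iff_coeff_eq_zero]
    intro N hN
    rcases Nat.lt_or_ge (k + 2) N with h1 | h1
    · rw [hq, coeff_sub, coeff_eq_zero_of_natDegree_lt, coeff_eq_zero_of_natDegree_lt, sub_zero]
      · rw [hA.natDegree_eq]; exact h1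
      · rw [natDegree_X_mul hB.monic.ne_zero, hB.natDegree_eq]; exact h1
    · rcases (by lia : N = k + 1 ∨ N = k + 2) with rfl | rfl
      · exact coeff_eq_zero_of_comp_neg_X hpar ⟨k, by ring⟩
      · have h2 := hA.monic.coeff_natDegree
        have h3 := hB.monic.coeff_natDegree
        rw [hA.natDegree_eq] at h2
        rw [hB.natDegree_eq] at h3
        rw [hq, coeff_sub, coeff_X_mul, h2, h3, sub_self]
  have hBpos := sum_mul_sq_pos hw hB.monic.ne_zero (by
    rw [degree_eq_natDegree hB.monic.ne_zero, hB.natDegree_eq]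
    exact_mod_cast hk)
  -- the pairing of `q` with a monic polynomial of degree `k` is the squared norm of `B`
  have hpair (r : ℝ[X]) (hr : r.natDegree ≤ k) :
      ∑ x ∈ s, w x * (q.eval x * r.eval x)
        = r.coeff k * ∑ x ∈ s, w x * (B.eval x * B.eval x) := by
    -- Modulo polynomials orthogonal to B, X r may be replaced by a multiple of B.
    have hd : (X * r - C (r.coeff k) * B).degree < ((k + 1 : ℕ) : WithBot ℕ) := by
      rw [degree_lt_iff_coeff_zero]
      intro m hm
      rw [coeff_sub, coeff_C_mul]
      rcases Nat.eq_or_lt_of_le hm with rfl | hm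
      · have h3 := hB.monic.coeff_natDegree
        rw [hB.natDegree_eq] at h3
        rw [coeff_X_mul, h3, mul_one, sub_self]
      · rw [coeff_eq_zero_of_natDegree_lt (p := B) (by rwa [hB.natDegree_eq]),
          coeff_eq_zero_of_natDegree_lt (p := X * r), mul_zero, sub_zero]
        refine natDegree_mul_le.trans_lt ?_
        rw [natDegree_X]
        lia
    have h1 := hB.orthogonal _ hd
    have h2 := hA.orthogonal r ((degree_le_natDegree).trans_lt
      (by exact_mod_cast (by lia : r.natDegree < k + 2)))
    rw [Finset.mul_sum]
    rw [← sub_eq_zero, ← Finset.sum_sub_distrib]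
    have h3 := congrArg₂ (· - ·) h1 h2
    simp only [sub_zero] at h3
    rw [← Finset.sum_sub_distrib] at h3
    rw [← h3]
    refine Finset.sum_congr rfl fun x _ => ?_
    simp only [hq, eval_sub, eval_mul, eval_X, eval_C]
    ring
  have hq0 : q ≠ 0 := by
    intro h0
    have := hpair (X ^ k) (by simp)
    rw [h0] at this
    simp at this
    exact hBpos.ne' this.symm
  have hqdeg : q.degree < s.card :=
    (degree_le_natDegree).trans_lt (by exact_mod_cast (by lia : q.natDegree < s.card))
  have hlpos : 0 < l := by
    have h1 := sum_mul_sq_pos hw hq0 hqdeg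
    rw [hpair q hdeg, hcoeff] at h1
    exact (pos_iff_pos_of_mul_pos h1).2 hBpos
  have heq : -C (1 / l) * (A - X * B) = C (1 / l) * q := by
    rw [hq]; ring
  have hcm : (C (1 / l) * q).coeff k = 1 := by
    rw [coeff_C_mul, hcoeff, one_div_mul_cancel hlpos.ne']
  have hcd : (C (1 / l) * q).natDegree ≤ k := (natDegree_C_mul_le _ _).trans hdeg
  rw [heq]
  refine ⟨hlpos, monic_of_natDegree_le_of_coeff_eq_one k hcd hcm,
    hcd.antisymm (le_natDegree_of_ne_zero (by rw [hcm]; exact one_ne_zero)), ?_, horth.C_mul _⟩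
  rw [mul_comp, C_comp, hpar]
  ring

/-! ### Ultraspherical polynomials: coefficients, connection formula, structure relation. -/

lemma isThreeTerm_ultraspherical (lam : ℝ) :
    IsThreeTerm (fun k => ultrasphericalCoeff lam (k + 2)) (ultraspherical lam) :=
  ⟨by simp [ultraspherical], by simp [ultraspherical], fun k => by simp [ultraspherical]⟩

lemma ultrasphericalCoeff_add_two (lam : ℝ) (k : ℕ) : ultrasphericalCoeff lam (k + 2)
    = ((k + 1) * (k + 2 * lam)) / (4 * (k + lam) * (k + 1 + lam)) := by
  unfold ultrasphericalCoeff
  push_cast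
  congr 1 <;> ring

/-- The recurrence coefficients are positive in the classical range. -/
lemma ultrasphericalCoeff_pos {mu : ℝ} (hmu : -1 / 2 < mu) (hmu0 : mu ≠ 0) (k : ℕ) :
    0 < ultrasphericalCoeff mu (k + 2) := by
  rw [ultrasphericalCoeff_add_two]
  rcases Nat.eq_zero_or_pos k with rfl | hk
  -- At k = 0 the factor `mu` cancels, so its sign is irrelevant.
  · have : ((((0 : ℕ) : ℝ) + 1) * ((0 : ℕ) + 2 * mu)) / (4 * ((0 : ℕ) + mu) * ((0 : ℕ) + 1 + mu))
        = 1 / (2 * (1 + mu)) := by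
      have : 1 + mu ≠ 0 := by linarith
      push_cast
      simp only [zero_add]
      field_simp
      ring
    rw [this]
    have : 0 < 1 + mu := by linarith
    positivity
  · have hk1 : (1 : ℝ) ≤ k := by exact_mod_cast hk
    have h1 : 0 < (k : ℝ) + 2 * mu := by linarith
    have h2 : 0 < (k : ℝ) + mu := by linarith
    have h3 : 0 < (k : ℝ) + 1 + mu := by linarith
    positivity

/-- The coefficient in the connection formula `ultraspherical_add_two_eq`. -/
noncomputable def connectionCoeff (lam : ℝ) (k : ℕ) : ℝ := (k + 1) / (2 * (k + 1 + lam))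

section

variable {lam : ℝ}

lemma natCast_add_ne_zero (hlam : lam ∈ Set.Ioo (-3 / 2 : ℝ) (-1 / 2)) (hlam1 : lam ≠ -1)
    (k : ℕ) : (k : ℝ) + lam ≠ 0 := by
  obtain ⟨h1, h2⟩ := hlam
  match k with
  | 0 => intro h; push_cast at h; linarith
  | 1 => intro h; push_cast at h; exact hlam1 (by linarith)
  | k + 2 =>
    have : (0 : ℝ) ≤ k := k.cast_nonneg
    push_cast
    intro h
    linarith

/-- In this range some coefficients are negative. Being nonzero is enough to exclude common zeros of
consecutive polynomials. -/
lemma ultrasphericalCoeff_ne_zero (hlam : lam ∈ Set.Ioo (-3 / 2 : ℝ) (-1 / 2)) (hlam1 : lam ≠ -1)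
    (k : ℕ) : ultrasphericalCoeff lam (k + 2) ≠ 0 := by
  rw [ultrasphericalCoeff_add_two]
  have h1 := natCast_add_ne_zero hlam hlam1 k
  have h2 := natCast_add_ne_zero hlam hlam1 (k + 1)
  push_cast at h2
  have h3 : (k : ℝ) + 2 * lam ≠ 0 := by
    obtain ⟨h1, h2⟩ := hlam
    match k with
    | 0 => intro h; push_cast at h; linarith
    | 1 => intro h; push_cast at h; linarith
    | 2 => intro h; push_cast at h; exact hlam1 (by linarith)
    | k + 3 =>
      have : (0 : ℝ) ≤ k := k.cast_nonneg
      push_cast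
      intro h
      linarith
  have : (k : ℝ) + 1 ≠ 0 := by positivity
  positivity

lemma connectionCoeff_zero (h0 : lam ≠ 0) (h1 : 1 + lam ≠ 0) :
    connectionCoeff lam 0 = ultrasphericalCoeff lam 2 := by
  rw [connectionCoeff, ultrasphericalCoeff_add_two lam 0]
  push_cast
  simp only [zero_add]
  field_simp
  ring

/-- Together with `connectionCoeff_mul`, this is the comparison of coefficients in the inductive
step of the connection formula. -/
lemma connectionCoeff_add (k : ℕ) (h1 : k + 1 + lam ≠ 0) (h2 : k + 2 + lam ≠ 0) :
    connectionCoeff lam k + ultrasphericalCoeff lam (k + 3)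
      = ultrasphericalCoeff (lam + 1) (k + 2) + connectionCoeff lam (k + 1) := by
  rw [connectionCoeff, connectionCoeff, ultrasphericalCoeff_add_two lam (k + 1),
    ultrasphericalCoeff_add_two]
  push_cast
  rw [show (k : ℝ) + (lam + 1) = k + 1 + lam by ring,
    show (k : ℝ) + 1 + 1 + lam = k + 2 + lam by ring,
    show (k : ℝ) + 1 + (lam + 1) = k + 2 + lam by ring]
  field_simp
  ring

lemma connectionCoeff_mul (k : ℕ) (h1 : k + 1 + lam ≠ 0) (h2 : k + 2 + lam ≠ 0)
    (h3 : k + 3 + lam ≠ 0) :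
    ultrasphericalCoeff lam (k + 4) * connectionCoeff lam k
      = connectionCoeff lam (k + 2) * ultrasphericalCoeff (lam + 1) (k + 2) := by
  rw [connectionCoeff, connectionCoeff, ultrasphericalCoeff_add_two lam (k + 2),
    ultrasphericalCoeff_add_two]
  push_cast
  rw [show (k : ℝ) + (lam + 1) = k + 1 + lam by ring,
    show (k : ℝ) + 2 + 1 + lam = k + 3 + lam by ring,
    show (k : ℝ) + 1 + (lam + 1) = k + 2 + lam by ring]
  field_simp
  ring

/-- The connection formula between the parameters `lam` and `lam + 1`. -/
lemma ultraspherical_add_two_eq (hlam : ∀ k : ℕ, k + lam ≠ 0) (k : ℕ) : ultraspherical lam (k + 2)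
    = X * ultraspherical (lam + 1) (k + 1)
      - C (connectionCoeff lam k) * ultraspherical (lam + 1) k := by
  have hC := isThreeTerm_ultraspherical lam
  have hP := isThreeTerm_ultraspherical (lam + 1)
  have h0 : lam ≠ 0 := by simpa using hlam 0
  have h1 (j : ℕ) : j + 1 + lam ≠ 0 := by exact_mod_cast hlam (j + 1)
  have h2 (j : ℕ) : j + 2 + lam ≠ 0 := by exact_mod_cast hlam (j + 2)
  have h3 (j : ℕ) : j + 3 + lam ≠ 0 := by exact_mod_cast hlam (j + 3)
  have hzero := connectionCoeff_zero h0 (by simpa using h1 0)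
  induction k using Nat.twoStepInduction with
  | zero => rw [hC.add_two, hC.one, hC.zero, hP.one, hP.zero, hzero]
  | one =>
    rw [hC.add_two, hC.add_two, hC.one, hC.zero, hP.add_two, hP.one, hP.zero]
    have key := congrArg (C : ℝ → ℝ[X]) (connectionCoeff_add 0 (h1 0) (h2 0))
    rw [hzero] at key
    simp only [C_add] at key
    linear_combination (-X) * key
  | more k ih1 ih2 =>
    have hp := hP.add_two k
    have hp' : ultraspherical (lam + 1) (k + 3) = _ := hP.add_two (k + 1)
    have hc : ultraspherical lam (k + 4) = _ := hC.add_two (k + 2)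
    have key1 := congrArg (C : ℝ → ℝ[X]) (connectionCoeff_add (k + 1) (h1 _) (h2 _))
    have key2 := congrArg (C : ℝ → ℝ[X]) (connectionCoeff_mul k (h1 _) (h2 _) (h3 _))
    simp only [C_add, C_mul] at key1 key2
    change ultraspherical lam (k + 4) = X * ultraspherical (lam + 1) (k + 3)
      - C (connectionCoeff lam (k + 2)) * ultraspherical (lam + 1) (k + 2)
    rw [hc, hp', ih1, show k + 2 + 1 = k + 1 + 2 from rfl, ih2]
    linear_combination (-X * ultraspherical (lam + 1) (k + 1)) * key1
      + ultraspherical (lam + 1) k * key2 + C (connectionCoeff lam (k + 2)) * hp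

lemma ultrasphericalCoeff_succ_mul (k : ℕ) (h0 : k + lam ≠ 0) (h1 : k + 1 + lam ≠ 0)
    (h2 : k + 2 + lam ≠ 0) :
    2 * (k + 2 + lam) * ultrasphericalCoeff lam (k + 3)
      = 1 + 2 * (k + lam) * ultrasphericalCoeff lam (k + 2) := by
  rw [ultrasphericalCoeff_add_two lam (k + 1), ultrasphericalCoeff_add_two]
  push_cast
  rw [show (k : ℝ) + 1 + 1 + lam = k + 2 + lam by ring]
  field_simp
  ring

/-- The structure relation for the derivative. -/
lemma X_sq_sub_one_mul_derivative_ultraspherical (hlam : ∀ k : ℕ, k + lam ≠ 0) (k : ℕ) :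
    (X ^ 2 - 1) * derivative (ultraspherical lam k)
      = C (2 * (k + lam)) * ultraspherical lam (k + 1)
        - C (k + 2 * lam) * (X * ultraspherical lam k) := by
  have hC := isThreeTerm_ultraspherical lam
  have h1 (j : ℕ) : j + 1 + lam ≠ 0 := by exact_mod_cast hlam (j + 1)
  have h2 (j : ℕ) : j + 2 + lam ≠ 0 := by exact_mod_cast hlam (j + 2)
  induction k using Nat.twoStepInduction with
  | zero => simp [hC.zero, hC.one]
  | one =>
    rw [hC.add_two, hC.one, hC.zero]
    have h0 : lam ≠ 0 := by simpa using hlam 0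
    have h1' : 1 + lam ≠ 0 := by simpa using h1 0
    have key : 2 * (1 + lam) * ultrasphericalCoeff lam 2 = 1 := by
      rw [← connectionCoeff_zero h0 h1', connectionCoeff]
      push_cast
      simp only [zero_add]
      field_simp
    have key' := congrArg (C : ℝ → ℝ[X]) key
    simp only [C_mul, C_add, C_1, derivative_X, Nat.cast_one, mul_one, map_ofNat] at key' ⊢
    linear_combination key'
  | more k ih1 ih2 =>
    have hc := hC.add_two k
    have hc' : ultraspherical lam (k + 3) = _ := hC.add_two (k + 1)
    have hd := congrArg derivative hc
    have key := congrArg (C : ℝ → ℝ[X])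
      (ultrasphericalCoeff_succ_mul k (hlam k) (h1 k) (h2 k))
    simp only [derivative_sub, derivative_mul, derivative_X, derivative_C] at hd
    push_cast at ih1 ih2 ⊢
    simp only [C_mul, C_add, C_1, map_ofNat, map_natCast] at key ih1 ih2 ⊢
    rw [hc']
    linear_combination (X ^ 2 - 1) * hd + X * ih2 - C (ultrasphericalCoeff lam (k + 2)) * ih1
      + ultraspherical lam (k + 1) * key + (X * (k + 2 * C lam)) * hc

end

/-! ### Weights on the zeros and the initial pair. -/

/-- Two monic polynomials of definite parity and consecutive degrees, the larger one with real
simple zeros that are strictly interlaced by those of the smaller one, are orthogonal with respect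
to positive weights on the zeros. -/
lemma exists_weights {N : ℕ} {A B : ℝ[X]} (hA : A.Monic) (hAd : A.natDegree = N + 1)
    (hAp : A.comp (-X) = (-1) ^ (N + 1) * A) (hB : B.Monic) (hBd : B.natDegree = N)
    (hBp : B.comp (-X) = (-1) ^ N * B) (hreal : ∀ z : ℂ, aeval z A = 0 → z.im = 0)
    (hpos : ∀ x : ℝ, A.eval x = 0 → 0 < A.derivative.eval x * B.eval x) :
    ∃ w : ℝ → ℝ, A.roots.toFinset.card = N + 1 ∧ (∀ x ∈ A.roots.toFinset, 0 < w x) ∧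
      IsSymmMonicOrthogonal A.roots.toFinset w (N + 1) A ∧
      IsSymmMonicOrthogonal A.roots.toFinset w N B := by
  have hroot (x : ℝ) (hx : x ∈ A.roots.toFinset) : A.eval x = 0 :=
    isRoot_of_mem_roots (Multiset.mem_toFinset.1 hx)
  obtain ⟨hcard, hnodal⟩ := roots_toFinset_of_real_simple hA hreal
    fun x hx => left_ne_zero_of_mul (hpos x hx).ne'
  rw [hAd] at hcard
  refine ⟨fun x => 1 / (A.derivative.eval x * B.eval x), hcard,
    fun x hx => one_div_pos.2 (hpos x (hroot x hx)), ⟨hA, hAd, hAp, .of_vanishing hroot⟩,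
    ⟨hB, hBd, hBp, ?_⟩⟩
  exact .of_weights hcard hnodal fun x hx => right_ne_zero_of_mul (hpos x (hroot x hx)).ne'

section

variable {lam : ℝ}

/-- The index starts at 1 because `connectionCoeff lam 0` is negative for λ < -1. -/
lemma connectionCoeff_pos (hlam : -3 / 2 < lam) (k : ℕ) : 0 < connectionCoeff lam (k + 1) := by
  have : (0 : ℝ) ≤ k := k.cast_nonneg
  rw [connectionCoeff]
  push_cast
  have : 0 < (k : ℝ) + 1 + 1 + lam := by linarith
  positivity

/-- The shifted parameter λ + 1 lies in (-1/2, 1/2) and is nonzero, so its recurrence coefficients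
are positive and the half-plane argument applies. -/
lemma ultraspherical_im_eq_zero (hlam : lam ∈ Set.Ioo (-3 / 2 : ℝ) (-1 / 2)) (hlam1 : lam ≠ -1)
    {k : ℕ} {z : ℂ} (hz : aeval z (ultraspherical lam (k + 3)) = 0) : z.im = 0 := by
  have hC := isThreeTerm_ultraspherical lam
  have hP := isThreeTerm_ultraspherical (lam + 1)
  have hc (j : ℕ) : 0 < ultrasphericalCoeff (lam + 1) (j + 2) :=
    ultrasphericalCoeff_pos (by linarith [hlam.1]) (fun h => hlam1 (by linarith)) j
  refine im_eq_zero_of_aeval_eq_zero (hC.comp_neg_X (k + 3)) (fun w hw => ?_) hz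
  rw [ultraspherical_add_two_eq (natCast_add_ne_zero hlam hlam1) (k + 1)]
  exact hP.aeval_X_mul_sub_ne_zero hc hw (k + 1) (connectionCoeff_pos hlam.1 k).le

lemma ultraspherical_structure_eval (hlam : ∀ k : ℕ, k + lam ≠ 0) (k : ℕ) (x : ℝ) :
    (x ^ 2 - 1) * (ultraspherical lam k).derivative.eval x
      = 2 * (k + lam) * (ultraspherical lam (k + 1)).eval x
        - (k + 2 * lam) * (x * (ultraspherical lam k).eval x) := by
  have := congrArg (eval x) (X_sq_sub_one_mul_derivative_ultraspherical hlam k)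
  simpa only [eval_mul, eval_sub, eval_pow, eval_X, eval_one, eval_C] using this

/-- At x = 1 the structure relation reads 2(k + λ) C_{k+1}(1) = (k + 2λ) C_k(1). The sign comes from
1 + 2λ < 0 at k = 1. The factor 1 + λ cancels between k = 1 and k = 2, and all later factors are
positive. -/
lemma ultraspherical_eval_one_neg (hlam : lam ∈ Set.Ioo (-3 / 2 : ℝ) (-1 / 2)) (hlam1 : lam ≠ -1)
    (k : ℕ) : (ultraspherical lam (k + 3)).eval 1 < 0 := by
  have hs (j : ℕ) := ultraspherical_structure_eval (natCast_add_ne_zero hlam hlam1) j 1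
  obtain ⟨h1, h2⟩ := hlam
  induction k with
  | zero =>
    have e1 := hs 1
    have e2 := hs 2
    have e3 : (ultraspherical lam 1).eval 1 = 1 := by simp [ultraspherical]
    push_cast at e1 e2
    rw [e3] at e1
    have : 2 * (2 + lam) * (ultraspherical lam 3).eval 1 = 1 + 2 * lam := by
      linear_combination -e1 - e2
    by_contra! h
    have : 0 ≤ 2 * (2 + lam) * (ultraspherical lam 3).eval 1 :=
      mul_nonneg (by linarith) h
    linarith
  | succ k ih =>
    have e := hs (k + 3)
    push_cast at e
    have hk : (0 : ℝ) ≤ k := k.cast_nonneg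
    have : 2 * (k + 3 + lam) * (ultraspherical lam (k + 4)).eval 1
        = (k + 3 + 2 * lam) * (ultraspherical lam (k + 3)).eval 1 := by
      linear_combination -e
    by_contra! h
    have h3 : 0 ≤ 2 * (k + 3 + lam) * (ultraspherical lam (k + 4)).eval 1 :=
      mul_nonneg (by linarith) h
    have h4 : (k + 3 + 2 * lam) * (ultraspherical lam (k + 3)).eval 1 < 0 :=
      mul_neg_of_pos_of_neg (by linarith) ih
    linarith

lemma isGreatest_largestZero {P : ℝ[X]} (hP : P ≠ 0) (h : ∃ x, P.IsRoot x) :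
    IsGreatest {x : ℝ | P.IsRoot x} (largestZero P) := by
  have hfin : {x : ℝ | P.IsRoot x}.Finite := finite_setOfPred_isRoot hP
  exact ⟨Set.Nonempty.csSup_mem h hfin, fun x hx => le_csSup hfin.bddAbove hx⟩

lemma one_lt_largestZero_ultraspherical (hlam : lam ∈ Set.Ioo (-3 / 2 : ℝ) (-1 / 2))
    (hlam1 : lam ≠ -1) (k : ℕ) :
    IsGreatest {x : ℝ | (ultraspherical lam (k + 3)).IsRoot x}
      (largestZero (ultraspherical lam (k + 3))) ∧
    1 < largestZero (ultraspherical lam (k + 3)) := by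
  have hm := (isThreeTerm_ultraspherical lam).monic (k + 3)
  obtain ⟨x, hx, hx0⟩ := hm.exists_root_gt (ultraspherical_eval_one_neg hlam hlam1 k)
  have hg := isGreatest_largestZero hm.ne_zero ⟨x, hx0⟩
  exact ⟨hg, hx.trans_le (hg.2 hx0)⟩

/-- Write A for the product and B for C_{k+4}. By the structure relation, A' B = 2(k + 3 + λ) B² at
a zero of C_{k+3}, and (k + 3 + 2λ) A' B = 4(k + 3 + λ) B² at x = ±1. Here B ≠ 0, since consecutive
polynomials have no common zero. -/
lemma wendroff_interlacing (hlam : lam ∈ Set.Ioo (-3 / 2 : ℝ) (-1 / 2)) (hlam1 : lam ≠ -1)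
    (k : ℕ) {x : ℝ} (hx : ((X ^ 2 - 1) * ultraspherical lam (k + 3)).eval x = 0) :
    0 < ((X ^ 2 - 1) * ultraspherical lam (k + 3)).derivative.eval x
      * (ultraspherical lam (k + 4)).eval x := by
  have hC := isThreeTerm_ultraspherical lam
  have hs := ultraspherical_structure_eval (natCast_add_ne_zero hlam hlam1) (k + 3) x
  have hcommon (h : (ultraspherical lam (k + 4)).eval x = 0) :=
    hC.eval_ne_zero_of_eval_succ_eq_zero (ultrasphericalCoeff_ne_zero hlam hlam1) (k + 3) h
  have hk : (0 : ℝ) ≤ k := k.cast_nonneg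
  obtain ⟨h1, h2⟩ := hlam
  have hd : ((X ^ 2 - 1) * ultraspherical lam (k + 3)).derivative.eval x
      = 2 * x * (ultraspherical lam (k + 3)).eval x
        + (x ^ 2 - 1) * (ultraspherical lam (k + 3)).derivative.eval x := by
    simp [one_add_one_eq_two]
  rw [hd, hs]
  push_cast at hs ⊢
  simp only [eval_mul, eval_sub, eval_pow, eval_X, eval_one, mul_eq_zero] at hx
  have hp1 : 0 < 2 * ((k : ℝ) + 3 + lam) := by linarith
  have hp2 : 0 < (k : ℝ) + 3 + 2 * lam := by linarith
  rcases hx with hx | hx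
  · rw [hx, zero_mul, eq_comm, sub_eq_zero] at hs
    have hne : (ultraspherical lam (k + 4)).eval x ≠ 0 := by
      intro h0
      refine hcommon h0 ?_
      have hx0 : x ≠ 0 := by rintro rfl; norm_num at hx
      rw [h0, mul_zero, eq_comm] at hs
      simpa [hp2.ne', hx0] using hs
    have := mul_self_pos.2 hne
    have hmul : ((k : ℝ) + 3 + 2 * lam) * ((2 * x * (ultraspherical lam (k + 3)).eval x
        + (2 * (k + 3 + lam) * (ultraspherical lam (k + 4)).eval x
          - (k + 3 + 2 * lam) * (x * (ultraspherical lam (k + 3)).eval x)))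
            * (ultraspherical lam (k + 4)).eval x)
        = 2 * (2 * (k + 3 + lam)) * ((ultraspherical lam (k + 4)).eval x
          * (ultraspherical lam (k + 4)).eval x) := by
      change 2 * ((k : ℝ) + 3 + lam) * (ultraspherical lam (k + 4)).eval x = _ at hs
      linear_combination (-2 + (k + 3 + 2 * lam)) * (ultraspherical lam (k + 4)).eval x * hs
    refine (pos_iff_pos_of_mul_pos ?_).1 hp2
    rw [hmul]
    positivity
  · have hne : (ultraspherical lam (k + 4)).eval x ≠ 0 := fun h0 => hcommon h0 hx
    have := mul_self_pos.2 hne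
    rw [hx]
    have := mul_pos hp1 this
    change 0 < (2 * x * 0 + (2 * ((k : ℝ) + 3 + lam) * (ultraspherical lam (k + 4)).eval x
      - (k + 3 + 2 * lam) * (x * 0))) * (ultraspherical lam (k + 4)).eval x
    linarith

lemma wendroff_im_eq_zero (hlam : lam ∈ Set.Ioo (-3 / 2 : ℝ) (-1 / 2)) (hlam1 : lam ≠ -1)
    {k : ℕ} {z : ℂ} (hz : aeval z ((X ^ 2 - 1) * ultraspherical lam (k + 3)) = 0) : z.im = 0 := by
  simp only [map_mul, map_sub, map_pow, aeval_X, map_one, mul_eq_zero] at hz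
  rcases hz with hz | hz
  · rcases mul_self_eq_one_iff.1 ((sq z).symm.trans (sub_eq_zero.1 hz)) with rfl | rfl <;> simp
  · exact ultraspherical_im_eq_zero hlam hlam1 hz

lemma X_sq_sub_one_monic : (X ^ 2 - 1 : ℝ[X]).Monic := by
  simpa using monic_X_pow_sub_C (1 : ℝ) (two_ne_zero)

lemma X_sq_sub_one_natDegree : (X ^ 2 - 1 : ℝ[X]).natDegree = 2 := by
  simpa using natDegree_X_pow_sub_C (n := 2) (r := (1 : ℝ))

/-- Weights for the initial pair of the construction. -/
lemma exists_wendroff_weights (hlam : lam ∈ Set.Ioo (-3 / 2 : ℝ) (-1 / 2)) (hlam1 : lam ≠ -1)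
    (k : ℕ) : ∃ (s : Finset ℝ) (w : ℝ → ℝ), s.card = k + 5 ∧ (∀ x ∈ s, 0 < w x) ∧
      (∀ x ∈ s, x ≤ largestZero (ultraspherical lam (k + 3))) ∧
      IsSymmMonicOrthogonal s w (k + 5) ((X ^ 2 - 1) * ultraspherical lam (k + 3)) ∧
      IsSymmMonicOrthogonal s w (k + 4) (ultraspherical lam (k + 4)) := by
  have hC := isThreeTerm_ultraspherical lam
  have hm : ((X ^ 2 - 1) * ultraspherical lam (k + 3)).Monic :=
    X_sq_sub_one_monic.mul (hC.monic _)
  obtain ⟨w, h1, h2, h3, h4⟩ := exists_weights (N := k + 4) hm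
    (by rw [X_sq_sub_one_monic.natDegree_mul (hC.monic _), hC.natDegree_eq,
      X_sq_sub_one_natDegree]; ring)
    (by simp only [mul_comp, sub_comp, pow_comp, X_comp, one_comp, hC.comp_neg_X]; ring)
    (hC.monic _) (hC.natDegree_eq _) (hC.comp_neg_X _)
    (fun z hz => wendroff_im_eq_zero hlam hlam1 hz)
    (fun x hx => wendroff_interlacing hlam hlam1 k hx)
  refine ⟨_, w, h1, h2, fun x hx => ?_, h3, h4⟩
  obtain ⟨hg, hg1⟩ := one_lt_largestZero_ultraspherical hlam hlam1 k
  have h0 := isRoot_of_mem_roots (Multiset.mem_toFinset.1 hx)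
  simp only [IsRoot, eval_mul, eval_sub, eval_pow, eval_X, eval_one, mul_eq_zero] at h0
  rcases h0 with h0 | h0
  -- Here x = ±1, and the largest zero exceeds 1.
  · nlinarith
  · exact hg.2 h0

end

/-! ### Favard's theorem on a compact interval. -/

open Filter Topology in
/-- A finite convex combination of point masses, as a probability measure. -/
lemma exists_probabilityMeasure_integral_eq_sum {ι Y : Type*} [MeasurableSpace Y]
    [MeasurableSingletonClass Y] (s : Finset ι) (w : ι → ℝ) (f : ι → Y)
    (hw : ∀ i ∈ s, 0 ≤ w i) (hsum : ∑ i ∈ s, w i = 1) :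
    ∃ μ : ProbabilityMeasure Y, ∀ g : Y → ℝ,
      ∫ y, g y ∂(μ : Measure Y) = ∑ i ∈ s, w i * g (f i) := by
  let μ : Measure Y := ∑ i ∈ s, ENNReal.ofReal (w i) • Measure.dirac (f i)
  have hμ : IsProbabilityMeasure μ := by
    constructor
    simp only [μ, Measure.finsetSum_apply, Measure.smul_apply, measure_univ, smul_eq_mul, mul_one]
    rw [← ENNReal.ofReal_sum_of_nonneg hw, hsum, ENNReal.ofReal_one]
  refine ⟨⟨μ, hμ⟩, fun g => ?_⟩
  change ∫ y, g y ∂μ = _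
  rw [integral_finsetSum_measure fun i _ =>
    (integrable_dirac (by simp)).smul_measure ENNReal.ofReal_ne_top]
  refine Finset.sum_congr rfl fun i hi => ?_
  rw [integral_smul_measure, integral_dirac, ENNReal.toReal_ofReal (hw i hi), smul_eq_mul]

namespace IsThreeTerm

variable {c : ℕ → ℝ} {D : ℕ → ℝ[X]}

lemma orthogonalBelow (h : IsThreeTerm c D) (hc : ∀ k, 0 < c k) {s : Finset ℝ} {w : ℝ → ℝ}
    {N : ℕ} (h1 : OrthogonalBelow s w (N + 1) (D (N + 1))) (h2 : OrthogonalBelow s w N (D N))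
    (i j : ℕ) (hij : i + j = N) :
    OrthogonalBelow s w (j + 1) (D (j + 1)) ∧ OrthogonalBelow s w j (D j) := by
  induction i generalizing j with
  | zero =>
    obtain rfl : j = N := by lia
    exact ⟨h1, h2⟩
  | succ i ih =>
    obtain ⟨h3, h4⟩ := ih (j + 1) (by lia)
    refine ⟨h4, ?_⟩
    have h5 := ((h3.mono (by lia)).X_mul_sub h4).C_mul (1 / c j)
    have h6 : C (1 / c j) * (X * D (j + 1) - D (j + 2)) = D j := by
      have : C (1 / c j) * C (c j) = (1 : ℝ[X]) := by
        rw [← C_mul, one_div_mul_cancel (hc j).ne', C_1]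
      rw [h.add_two]
      linear_combination D j * this
    rwa [h6] at h5

lemma degree_eq (h : IsThreeTerm c D) (k : ℕ) : (D k).degree = k := by
  rw [degree_eq_natDegree (h.monic k).ne_zero, h.natDegree_eq]

/-- After normalization the squared norms depend on `c` alone, so quadratures of different orders
agree on low degrees. -/
lemma sum_mul_eq (h : IsThreeTerm c D) {s : Finset ℝ} {w : ℝ → ℝ} {N : ℕ}
    (horth : ∀ k ≤ N + 1, OrthogonalBelow s w k (D k)) {i : ℕ} (hi : i ≤ N) :
    ∑ x ∈ s, w x * ((D i).eval x * (D i).eval x)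
      = (∏ k ∈ Finset.range i, c k) * ∑ x ∈ s, w x := by
  induction i with
  | zero => simp [h.zero]
  | succ i ih =>
    rw [Finset.prod_range_succ, mul_right_comm, ← ih (by lia), Finset.sum_mul]
    have hdeg : (D (i + 1) - X * D i).degree < ((i + 1 : ℕ) : WithBot ℕ) := by
      rw [← h.degree_eq (i + 1)]
      refine degree_sub_lt_left ?_ (h.monic _).ne_zero ?_
      · rw [mul_comm, degree_mul_X, h.degree_eq, h.degree_eq]
        norm_cast
      · rw [(monic_X.mul (h.monic i)).leadingCoeff, (h.monic _).leadingCoeff]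
    -- Adding the vanishing pairings of D_{i+1} with D_{i+1} - X D_i and of D_{i+2} with D_i leaves
    -- ‖D_{i+1}‖² - c_i ‖D_i‖².
    have h1 := horth (i + 1) (by lia) _ hdeg
    have h2 := horth (i + 2) (by lia) (D i)
      (by rw [h.degree_eq]; exact_mod_cast (by lia : i < i + 2))
    rw [← sub_eq_zero, ← Finset.sum_sub_distrib, ← add_zero 0]
    nth_rewrite 1 [← h1]
    rw [← h2, ← Finset.sum_add_distrib]
    refine Finset.sum_congr rfl fun x _ => ?_
    rw [h.eval_add_two]
    simp only [eval_sub, eval_mul, eval_X]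
    ring

/-- Moments of the Gauss quadrature measures. -/
lemma exists_probabilityMeasure (h : IsThreeTerm c D) (hc : ∀ k, 0 < c k) {a : ℝ}
    (ha : ∀ k, 0 < (D k).eval a) (N : ℕ) : ∃ μ : ProbabilityMeasure (Set.Icc (-a) a),
      ∀ i ≤ N, ∀ j ≤ N, ∫ x : Set.Icc (-a) a,
        (D i).eval (x : ℝ) * (D j).eval (x : ℝ) ∂(μ : Measure _)
        = if i = j then ∏ k ∈ Finset.range i, c k else 0 := by
  have ha0 : 0 < a := by simpa [h.one] using ha 1
  -- The nodes are the zeros of D_{N+2}, which gives orthogonality of D_k up to k = N + 1.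
  obtain ⟨w, hcard, hw, hA, hB⟩ := exists_weights (h.monic (N + 2)) (h.natDegree_eq _)
    (h.comp_neg_X _) (h.monic (N + 1)) (h.natDegree_eq _) (h.comp_neg_X _)
    (fun z hz => h.im_eq_zero hc hz)
    (fun x hx => by simpa [hx] using h.wronskian_pos hc x (N + 1))
  set s := (D (N + 2)).roots.toFinset
  have hmem (x : ℝ) (hx : x ∈ s) : x ∈ Set.Icc (-a) a := by
    have h0 : (D (N + 2)).eval x = 0 := isRoot_of_mem_roots (Multiset.mem_toFinset.1 hx)
    have h1 : aeval (x : ℂ) (D (N + 2)) = 0 := by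
      have := aeval_algebraMap_apply ℂ x (D (N + 2))
      simpa [coe_aeval_eq_eval, h0] using this
    obtain ⟨y, hy, hxy⟩ := h.zeros_mem_Ioo hc ha h1
    rw [Complex.ofReal_inj.1 hxy]
    exact Set.Ioo_subset_Icc_self hy
  have horth (k : ℕ) (hk : k ≤ N + 1) : OrthogonalBelow s w k (D k) :=
    (h.orthogonalBelow hc hA.orthogonal hB.orthogonal (N + 1 - k) k (by lia)).2
  have hne : s.Nonempty := Finset.card_pos.1 (by lia)
  have hW : 0 < ∑ x ∈ s, w x := Finset.sum_pos hw hne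
  -- `Set.projIcc` only moves the nodes into the subtype; it fixes each of them.
  obtain ⟨μ, hμ⟩ := exists_probabilityMeasure_integral_eq_sum s (fun x => w x / ∑ x ∈ s, w x)
    (Set.projIcc (-a) a (by linarith)) (fun x hx => (div_pos (hw x hx) hW).le)
    (by rw [← Finset.sum_div, div_self hW.ne'])
  refine ⟨μ, fun i hi j hj => ?_⟩
  have hint : ∫ x : Set.Icc (-a) a, (D i).eval (x : ℝ) * (D j).eval (x : ℝ) ∂(μ : Measure _)
      = (∑ x ∈ s, w x * ((D i).eval x * (D j).eval x)) / ∑ x ∈ s, w x := by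
    rw [hμ, Finset.sum_div]
    refine Finset.sum_congr rfl fun x hx => ?_
    rw [Set.projIcc_of_mem _ (hmem x hx)]
    ring
  rw [hint]
  split_ifs with hij
  · subst hij
    rw [h.sum_mul_eq horth (by lia), mul_div_cancel_right₀ _ hW.ne']
  · rcases Nat.lt_or_gt_of_ne hij with hij | hij
    · have := horth j (by lia) (D i) (by rw [h.degree_eq]; exact_mod_cast hij)
      simp only [mul_comm ((D j).eval _)] at this
      rw [this, zero_div]
    · rw [horth i (by lia) (D j) (by rw [h.degree_eq]; exact_mod_cast hij), zero_div]

open Filter Topology in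
/-- A Favard theorem with compact support: if all terms are positive at `a`, the sequence is
orthogonal with respect to a positive measure on `[-a, a]`. -/
theorem exists_measure (h : IsThreeTerm c D) (hc : ∀ k, 0 < c k) {a : ℝ}
    (ha : ∀ k, 0 < (D k).eval a) :
    ∃ μ : Measure ℝ, μ (Set.Icc (-a) a)ᶜ = 0 ∧ IsMonicOrthogonal D μ := by
  choose μs hμs using h.exists_probabilityMeasure hc ha
  -- Probability measures on a compact interval form a compact space, so a limit along an
  -- ultrafilter exists. Each integral of D_i D_j is constant once N ≥ max i j, hence passes to the
  -- limit.
  obtain ⟨μ, -, hμ⟩ := isCompact_univ.ultrafilter_le_nhds ((hyperfilter ℕ).map μs) (by simp)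
  have htend : Tendsto μs (hyperfilter ℕ : Filter ℕ) (𝓝 μ) := hμ
  have hemb : MeasurableEmbedding ((↑) : Set.Icc (-a) a → ℝ) :=
    MeasurableEmbedding.subtype_coe measurableSet_Icc
  let F (i j : ℕ) : BoundedContinuousFunction (Set.Icc (-a) a) ℝ :=
    BoundedContinuousFunction.mkOfCompact
      ⟨fun x => (D i).eval (x : ℝ) * (D j).eval (x : ℝ), by fun_prop⟩
  have hF (i j : ℕ) : ∫ x, F i j x ∂(μ : Measure (Set.Icc (-a) a))
      = if i = j then ∏ k ∈ Finset.range i, c k else 0 := by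
    have h1 := ProbabilityMeasure.tendsto_iff_forall_integral_tendsto.1 htend (F i j)
    refine tendsto_nhds_unique (h1.congr' ?_) tendsto_const_nhds
    have h2 : ∀ᶠ N in (hyperfilter ℕ : Filter ℕ), max i j ≤ N := by
      have : (hyperfilter ℕ : Filter ℕ) ≤ atTop := by
        rw [← Nat.cofinite_eq_atTop]; exact hyperfilter_le_cofinite
      exact this (eventually_ge_atTop _)
    filter_upwards [h2] with N hN
    exact hμs N i (by lia) j (by lia)
  have hint (i j : ℕ) : ∫ x, (D i).eval x * (D j).eval x
      ∂((μ : Measure (Set.Icc (-a) a)).map (↑))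
      = if i = j then ∏ k ∈ Finset.range i, c k else 0 := by
    rw [hemb.integral_map]
    exact hF i j
  refine ⟨(μ : Measure (Set.Icc (-a) a)).map (↑), ?_, h.monic, h.natDegree_eq, fun i j => ?_,
    fun i j hij => ?_, fun i => ?_⟩
  · rw [hemb.map_apply]
    convert measure_empty (μ := (μ : Measure (Set.Icc (-a) a)))
    ext x
    simp
  · rw [hemb.integrable_map_iff]
    exact (F i j).integrable _
  · rw [hint, if_neg hij]
  · rw [hint, if_pos rfl]
    exact Finset.prod_pos fun k _ => hc k

end IsThreeTerm

/-! ### The sequence D_m and its recurrence. -/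

section

variable {n : ℕ} {lam : ℝ} {ℓ : ℕ → ℝ}

lemma wendroffSeq_of_le {m : ℕ} (hm : m ≤ n) :
    wendroffSeq n lam ℓ m = wendroffBackward n lam (n - m) := by
  rcases hm.lt_or_eq with h | rfl
  · simp [wendroffSeq, h]
  · simp [wendroffSeq, wendroffForward, wendroffBackward]

lemma wendroffSeq_add (k : ℕ) : wendroffSeq n lam ℓ (n + k) = wendroffForward n lam ℓ k := by
  simp [wendroffSeq]

lemma wendroffSeq_forward (hn : 1 ≤ n) (k : ℕ) : wendroffSeq n lam ℓ (n + k + 1)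
    = X * wendroffSeq n lam ℓ (n + k) - C (ℓ (n + k + 1)) * wendroffSeq n lam ℓ (n + k - 1) := by
  cases k with
  | zero =>
    rw [add_assoc n 0 1, wendroffSeq_add, wendroffSeq_add,
      wendroffSeq_of_le (m := n + 0 - 1) (by lia), show n - (n + 0 - 1) = 1 by lia]
    simp [wendroffForward, wendroffBackward]
  | succ k =>
    rw [add_assoc n (k + 1) 1, wendroffSeq_add, wendroffSeq_add,
      show n + (k + 1) - 1 = n + k from rfl, wendroffSeq_add]
    rfl

lemma wendroffBackward_orthogonal {s : Finset ℝ} {w : ℝ → ℝ} (hw : ∀ x ∈ s, 0 < w x)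
    (hs : n ≤ s.card) (h0 : IsSymmMonicOrthogonal s w n (wendroffBackward n lam 0))
    (h1 : IsSymmMonicOrthogonal s w (n - 1) (wendroffBackward n lam 1)) (i j : ℕ)
    (hij : i + j + 1 = n) :
    IsSymmMonicOrthogonal s w (j + 1) (wendroffBackward n lam i) ∧
    IsSymmMonicOrthogonal s w j (wendroffBackward n lam (i + 1)) := by
  induction i generalizing j with
  | zero =>
    obtain rfl : n = j + 1 := by lia
    exact ⟨h0, h1⟩
  | succ i ih =>
    obtain ⟨hA, hB⟩ := ih (j + 1) (by lia)
    refine ⟨hB, ?_⟩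
    have := (IsSymmMonicOrthogonal.backward hw (by lia) hA hB).2
    rw [wendroffBackward, show n - i - 1 = j + 1 by lia, show n - i = j + 2 by lia]
    exact this

lemma wendroffSeq_orthogonal {s : Finset ℝ} {w : ℝ → ℝ} (hw : ∀ x ∈ s, 0 < w x)
    (hs : n ≤ s.card) (h0 : IsSymmMonicOrthogonal s w n (wendroffBackward n lam 0))
    (h1 : IsSymmMonicOrthogonal s w (n - 1) (wendroffBackward n lam 1)) {m : ℕ} (hm : m ≤ n) :
    IsSymmMonicOrthogonal s w m (wendroffSeq n lam ℓ m) := by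
  rw [wendroffSeq_of_le hm]
  rcases hm.lt_or_eq with h | rfl
  · have := (wendroffBackward_orthogonal hw hs h0 h1 (n - m - 1) m (by lia)).2
    rwa [show n - m - 1 + 1 = n - m by lia] at this
  · simpa using h0

/-- The recurrence coefficients `ℓ_{k+2}` of the whole sequence. -/
noncomputable def wendroffCoeff (n : ℕ) (lam : ℝ) (ℓ : ℕ → ℝ) (k : ℕ) : ℝ :=
  if k + 2 ≤ n then subsubleadingCoeff (k + 1) (wendroffSeq n lam ℓ (k + 1))
    - subsubleadingCoeff (k + 2) (wendroffSeq n lam ℓ (k + 2)) else ℓ (k + 2)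

lemma isThreeTerm_wendroffSeq (hn : 1 ≤ n) {s : Finset ℝ} {w : ℝ → ℝ}
    (horth : ∀ m ≤ n, IsSymmMonicOrthogonal s w m (wendroffSeq n lam ℓ m))
    (hpos : ∀ k, 0 < wendroffCoeff n lam ℓ k) :
    IsThreeTerm (wendroffCoeff n lam ℓ) (wendroffSeq n lam ℓ) := by
  refine ⟨(horth 0 (by lia)).monic.natDegree_eq_zero.1 (horth 0 (by lia)).natDegree_eq, ?_,
    fun k => ?_⟩
  · have h1 := horth 1 hn
    have h2 := h1.monic.eq_X_add_C h1.natDegree_eq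
    rw [h2, coeff_eq_zero_of_comp_neg_X (j := 0) h1.comp_neg_X (by decide)]
    simp
  · have hk := hpos k
    rcases Nat.lt_or_ge n (k + 2) with h | h
    · obtain ⟨i, hi⟩ : ∃ i, k + 1 = n + i := ⟨k + 1 - n, by lia⟩
      have := wendroffSeq_forward (lam := lam) (ℓ := ℓ) hn i
      rw [← hi] at this
      rw [wendroffCoeff, if_neg (by lia)]
      exact this
    -- The backward definition, solved for D_{k+2}, is the three-term recurrence.
    · have hrec : wendroffSeq n lam ℓ k = -C (1 / wendroffCoeff n lam ℓ k)
          * (wendroffSeq n lam ℓ (k + 2) - X * wendroffSeq n lam ℓ (k + 1)) := by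
        rw [wendroffCoeff, if_pos h, wendroffSeq_of_le (m := k) (by lia),
          wendroffSeq_of_le (m := k + 1) (by lia), wendroffSeq_of_le h,
          show n - k = n - (k + 2) + 2 by lia, wendroffBackward,
          show n - (n - (k + 2)) - 1 = k + 1 by lia, show n - (n - (k + 2)) = k + 2 by lia,
          show n - (k + 2) + 1 = n - (k + 1) by lia]
      have hC : C (wendroffCoeff n lam ℓ k) * C (1 / wendroffCoeff n lam ℓ k) = (1 : ℝ[X]) := by
        rw [← C_mul, mul_one_div_cancel hk.ne', C_1]
      linear_combination C (wendroffCoeff n lam ℓ k) * hrec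
        + (wendroffSeq n lam ℓ (k + 2) - X * wendroffSeq n lam ℓ (k + 1)) * (-hC)

/-- Multiplied by D_{n+j-2}(a) > 0, the upper bound on ℓ_{n+j} becomes D_{n+j}(a) > 0. Admissibility
below step `k` thus settles all indices below n + k. -/
lemma wendroffSeq_eval_pos (hn : 1 ≤ n) {a : ℝ}
    (hpos : ∀ m ≤ n, 0 < (wendroffSeq n lam ℓ m).eval a) {k : ℕ}
    (hadm : ∀ j, 1 ≤ j → j < k → AdmissibleAt n lam a ℓ j) {m : ℕ} (hm : m < n + k) :
    0 < (wendroffSeq n lam ℓ m).eval a := by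
  induction m using Nat.strong_induction_on with
  | _ m ih =>
    rcases Nat.lt_or_ge n m with h | h
    · obtain ⟨i, rfl⟩ : ∃ i, m = n + i + 1 := ⟨m - n - 1, by lia⟩
      have h1 := (hadm (i + 1) (by lia) (by lia)).2
      rw [show n + (i + 1) - 1 = n + i from rfl, show n + (i + 1) - 2 = n + i - 1 by lia,
        lt_div_iff₀ (ih (n + i - 1) (by lia) (by lia))] at h1
      rw [wendroffSeq_forward hn]
      simp only [eval_sub, eval_mul, eval_X, eval_C]
      exact sub_pos.2 h1
    · exact hpos m h

end

theorem theorem3p1 (n : ℕ) (hn : 5 ≤ n) (lam : ℝ) (hlam : lam ∈ Set.Ioo (-3 / 2 : ℝ) (-1 / 2))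
    (hlam1 : lam ≠ -1) (ε : ℝ) (hε : 0 < ε) (a : ℝ)
    (ha : a = largestZero (ultraspherical lam (n - 2)) + ε) :
    -- the number `a` is well defined
    (IsGreatest {x : ℝ | (ultraspherical lam (n - 2)).IsRoot x}
        (largestZero (ultraspherical lam (n - 2))) ∧
      1 < largestZero (ultraspherical lam (n - 2))) ∧
    -- the forward coefficients can be chosen one after the other
    (∀ (ℓ : ℕ → ℝ) (k : ℕ), 1 ≤ k → (∀ j, 1 ≤ j → j < k → AdmissibleAt n lam a ℓ j) →
      0 < a * (wendroffSeq n lam ℓ (n + k - 1)).eval a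
        / (wendroffSeq n lam ℓ (n + k - 2)).eval a) ∧
    -- the result, for every admissible choice of the forward coefficients
    (∀ ℓ : ℕ → ℝ, (∀ j, 1 ≤ j → AdmissibleAt n lam a ℓ j) →
      -- the coefficients of the backward recurrence are positive
      (∀ m, 2 ≤ m → m ≤ n →
        0 < subsubleadingCoeff (m - 1) (wendroffSeq n lam ℓ (m - 1))
          - subsubleadingCoeff m (wendroffSeq n lam ℓ m)) ∧
      -- symmetry
      (∀ m, (wendroffSeq n lam ℓ m).comp (-X) = (-1) ^ m * wendroffSeq n lam ℓ m) ∧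
      -- orthogonality
      (∃ μ : Measure ℝ, μ (Set.Icc (-a) a)ᶜ = 0 ∧ IsMonicOrthogonal (wendroffSeq n lam ℓ) μ) ∧
      -- all complex zeros are real and lie in the open interval
      (∀ (m : ℕ) (z : ℂ), aeval z (wendroffSeq n lam ℓ m) = 0 →
        ∃ x : ℝ, x ∈ Set.Ioo (-a) a ∧ z = (x : ℂ))) := by
  obtain ⟨k, rfl⟩ : ∃ k, n = k + 5 := ⟨n - 5, by lia⟩
  rw [show k + 5 - 2 = k + 3 from rfl] at ha ⊢
  have hlarge := one_lt_largestZero_ultraspherical hlam hlam1 k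
  obtain ⟨s, w, hs, hw, hsle, h0, h1⟩ := exists_wendroff_weights hlam hlam1 k
  have horth (ℓ : ℕ → ℝ) (m : ℕ) (hm : m ≤ k + 5) :
      IsSymmMonicOrthogonal s w m (wendroffSeq (k + 5) lam ℓ m) :=
    wendroffSeq_orthogonal hw hs.ge (by rw [wendroffBackward]; exact h0)
      (by rw [wendroffBackward]; exact h1) hm
  -- The shift ε > 0 puts `a` strictly to the right of every node.
  have hpos (ℓ : ℕ → ℝ) (m : ℕ) (hm : m ≤ k + 5) : 0 < (wendroffSeq (k + 5) lam ℓ m).eval a :=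
    (horth ℓ m hm).orthogonal.eval_pos hw (horth ℓ m hm).monic (horth ℓ m hm).natDegree_eq
      (by lia) fun x hx => by linarith [hsle x hx]
  have ha0 : 0 < a := by linarith [hlarge.2]
  refine ⟨hlarge, fun ℓ j hj hadm => ?_, fun ℓ hadm => ?_⟩
  · have hp {m : ℕ} := wendroffSeq_eval_pos (by lia) (hpos ℓ) hadm (m := m)
    exact div_pos (mul_pos ha0 (hp (by lia))) (hp (by lia))
  · have hback (j : ℕ) (hj : j + 2 ≤ k + 5) :
        0 < subsubleadingCoeff (j + 1) (wendroffSeq (k + 5) lam ℓ (j + 1))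
          - subsubleadingCoeff (j + 2) (wendroffSeq (k + 5) lam ℓ (j + 2)) :=
      (IsSymmMonicOrthogonal.backward hw (by lia) (horth ℓ _ hj) (horth ℓ _ (by lia))).1
    have hc (j : ℕ) : 0 < wendroffCoeff (k + 5) lam ℓ j := by
      rw [wendroffCoeff]
      split_ifs with hj
      · exact hback j hj
      · have := (hadm (j + 2 - (k + 5)) (by lia)).1
        rwa [show k + 5 + (j + 2 - (k + 5)) = j + 2 by lia] at this
    have hD := isThreeTerm_wendroffSeq (by lia) (horth ℓ) hc
    have hp (m : ℕ) : 0 < (wendroffSeq (k + 5) lam ℓ m).eval a :=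
      wendroffSeq_eval_pos (by lia) (hpos ℓ) (k := m + 1) (fun j hj _ => hadm j hj) (by lia)
    refine ⟨fun m hm2 hmn => ?_, hD.comp_neg_X, hD.exists_measure hc hp,
      fun m z hz => hD.zeros_mem_Ioo hc hp hz⟩
    obtain ⟨j, rfl⟩ : ∃ j, m = j + 2 := ⟨m - 2, by lia⟩
    exact hback j hmn
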